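/- All graphs are finite and simple. A coloring of the vertices of a graph $G$ with $d$ colors is \emph{distinguishing} if only the trivial automorphism of $G$ preserves every color class. Let $\mathrm{Dist}(G)$ be the smallest $d$ for which $G$ has a distinguishing coloring with $d$ colors, let $\mathrm{Fix}(G)$ be the smallest size of a set $S$ of vertices such that only the trivial automorphism fixes $S$ pointwise, and, for $d\ge \mathrm{Dist}(G)$, let the \emph{$d$-paint cost} $\rho^d(G)$ be the minimum size of the complement of a color class over all distinguishing colorings of $G$ with $d$ colors. Let $\mathrm{Fdist}(G)$ be the smallest $d\ge \mathrm{Dist}(G)$ with $\rho^d(G)=\mathrm{Fix}(G)$. The \emph{paint cost spectrum} of $G$ is $$\bigl(\mathrm{Dist}(G);\ \rho^{\mathrm{Dist}(G)}(G),\ \rho^{\mathrm{Dist}(G)+1}(G),\ \dots,\ \rho^{\mathrm{Fix}(G)+1}(G)\bigr)$$ and its \emph{paint cost ratio} is $$\frac{\mathrm{Fix}(G)-\mathrm{Fdist}(G)+2}{\mathrm{Fix}(G)-\mathrm{Dist}(G)+2}.$$ Let $k\ge 2$ and $n\ge 1$, and let $T_k^n$ be a perfect $k$-ary tree of depth $n$,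 that is, a tree with $k^n$ leaves having a root of degree $k$ at distance $n$ from every leaf, and in which all other internal vertices have degree $k+1$. Then: - for $n=1$, the paint cost spectrum of $T_k^n$ is $(k;\,k-1)$ and the paint cost ratio is $1$; - for $n=2$, the paint cost spectrum is $(k;\,k^2-1,\,k(k-1),\dots,k(k-1))$, where the entry $k(k-1)$ occurs $k^2-2k+1$ times, and the paint cost ratio is $\dfrac{k^2-2k+1}{k^2-2k+2}$; - for $n\ge 3$, the paint cost spectrum is $$(k;\,k^n-1,\,(k-1)(k^2+1)k^{n-3},\,k^{n-1}(k-1),\dots,k^{n-1}(k-1)),$$ where the entry $k^{n-1}(k-1)$ occurs $k^{n-1}(k-1)-k$ times, and the paint cost ratio is $\dfrac{k^{n-1}(k-1)-k}{k^{n-1}(k-1)-k+2}$. -/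

import Mathlib

namespace PaintCost

variable {V : Type*}

/-- A colouring `c` of the vertices is distinguishing if the identity is the only automorphism
of `G` that maps every colour class to itself. -/
def IsDistinguishing (G : SimpleGraph V) {α : Type*} (c : V → α) : Prop :=
  ∀ φ : G ≃g G, (∀ v, c (φ v) = c v) → φ = RelIso.refl G.Adj

/-- `G` is `d`-distinguishable: it has a distinguishing colouring with `d` colours. -/
def IsDistinguishable (G : SimpleGraph V) (d : ℕ) : Prop :=
  ∃ c : V → Fin d, IsDistinguishing G c

/-- The distinguishing number of `G`: the least `d` for which `G` is `d`-distinguishable. -/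
noncomputable def distNumber (G : SimpleGraph V) : ℕ :=
  sInf {d | IsDistinguishable G d}

/-- A set of vertices is a fixing set if the identity is the only automorphism that fixes each
of its elements. -/
def IsFixingSet (G : SimpleGraph V) (S : Finset V) : Prop :=
  ∀ φ : G ≃g G, (∀ v ∈ S, φ v = v) → φ = RelIso.refl G.Adj

/-- The fixing number of `G`: the least size of a fixing set. -/
noncomputable def fixNumber (G : SimpleGraph V) : ℕ :=
  sInf {m | ∃ S : Finset V, IsFixingSet G S ∧ S.card = m}

/-- The paint cost of `d`-distinguishing `G`: the least size of the complement of a colour class,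
over all distinguishing colourings of `G` with `d` colours.  It is meaningful when `G` is
`d`-distinguishable. -/
noncomputable def paintCost [Fintype V] (G : SimpleGraph V) (d : ℕ) : ℕ :=
  sInf {m | ∃ (c : V → Fin d) (i : Fin d), IsDistinguishing G c ∧
    (Finset.univ.filter fun v => c v ≠ i).card = m}

/-- The frugal distinguishing number of `G`: the least `d` for which the paint cost of
`d`-distinguishing `G` is (defined and) equal to the fixing number. -/
noncomputable def frugalNumber [Fintype V] (G : SimpleGraph V) : ℕ :=
  sInf {d | IsDistinguishable G d ∧ paintCost G d = fixNumber G}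

/-- The paint cost spectrum of `G`: the distinguishing number `D`, together with the list of
the paint costs for `d = D, D + 1, …, F + 1` colours, where `F` is the fixing number. -/
noncomputable def paintCostSpectrum [Fintype V] (G : SimpleGraph V) : ℕ × List ℕ :=
  (distNumber G, (List.Ico (distNumber G) (fixNumber G + 2)).map (paintCost G))

/-- The paint cost ratio of `G`. -/
noncomputable def paintCostRatio [Fintype V] (G : SimpleGraph V) : ℚ :=
  ((fixNumber G : ℚ) - frugalNumber G + 2) / ((fixNumber G : ℚ) - distNumber G + 2)

/-- `G` is a perfect `k`-ary tree of depth `n` (for `k ≥ 2`, `n ≥ 1`): a tree with `k ^ n` leaves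
that has a vertex, the root, of degree `k` whose distance to every leaf is `n`, all other
internal vertices having degree `k + 1`. -/
def IsPerfectKaryTree [Fintype V] (G : SimpleGraph V) [DecidableRel G.Adj] (k n : ℕ) : Prop :=
  G.IsTree ∧ (Finset.univ.filter fun v => G.degree v = 1).card = k ^ n ∧
    ∃ r : V, G.degree r = k ∧ (∀ v, G.degree v = 1 → G.dist r v = n) ∧
      ∀ v, v ≠ r → G.degree v ≠ 1 → G.degree v = k + 1

end PaintCost

/-!
The distinguishing colourings of a perfect `k`-ary tree admit a recursive description. Every
automorphism fixes the root, which is the only vertex of degree `k`, and hence preserves levels; so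
a colouring is distinguishing exactly when at every vertex the coloured subtrees below its children
are pairwise non-isomorphic (`IsRooting.isDistinguishing_iff`). The isomorphism type of such a
coloured tree is the colour of its root together with a `k`-element set of isomorphism types of
depth one less; these types are the elements of `shapes`. All the invariants become questions about
the least cost of a shape, the cost being the number of vertices that do not have a fixed colour `w`
(`IsRooting.exists_isDistinguishing_iff`). Fixing sets are covered too, as the complements of
colour classes of distinguishing colourings with arbitrarily many colours.

* With fewer than `k` colours there are no shapes of positive depth. With exactly `k` colours there
  are `k` shapes of every depth, one for each colour of the root, so the cost is forced
  (`cost_of_card_eq`).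
* At most one of `k` sibling leaves has colour `w`, so the cost in depth `n` is at least
  `k ^ (n - 1) * (k - 1)` for any number of colours (`le_cost`). With at least `k + 2` colours this
  bound is attained: there are at least `k + 1` optimal shapes of depth `1`, and from `N ≥ k + 1`
  shapes of one depth one obtains `N.choose k ≥ N` shapes of the next (`exists_cost_eq_of_lt_card`).
* With `k + 1` colours there are exactly `k` optimal shapes of depth `1`, hence a single optimal
  shape of depth `2`. In depth `3` all but one of the `k` subtrees of depth `2` must therefore
  cost one more, which gives the factor `k ^ 2 * (k - 1) + (k - 1) = (k - 1) * (k ^ 2 + 1)`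
  (`le_cost_of_card_eq_succ`). There are again at least `k + 1` shapes of depth `3` and of that
  cost, so that nothing is lost in larger depths (`exists_cost_eq_of_card_eq_succ`).
-/

/-! ### The model tree and the shapes of its colourings -/

namespace PaintCost

open Finset

/-- The vertices of the model of the perfect `k`-ary tree of depth `n`: the root, and the vertices
of the `k` subtrees of depth `n - 1` hanging from it. -/
inductive Vtx (k : ℕ) : ℕ → Type
  | root {n : ℕ} : Vtx k n
  | child {n : ℕ} (i : Fin k) (t : Vtx k n) : Vtx k (n + 1)

namespace Vtx

variable {k n : ℕ}

/-- Splitting the model tree into its root and the subtrees below the root. -/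
def succEquiv (k n : ℕ) : Vtx k (n + 1) ≃ Option (Fin k × Vtx k n) where
  toFun
    | root => none
    | child i t => some (i, t)
  invFun
    | none => root
    | some (i, t) => child i t
  left_inv := by rintro (_ | _) <;> rfl
  right_inv := by rintro (_ | _) <;> rfl

/-- The model tree of depth `0` has a single vertex. -/
def zeroEquiv (k : ℕ) : Vtx k 0 ≃ Unit where
  toFun _ := ()
  invFun _ := root
  left_inv := by rintro (_ | _); rfl
  right_inv _ := rfl

instance instFintype (k : ℕ) : (n : ℕ) → Fintype (Vtx k n)
  | 0 => Fintype.ofEquiv _ (zeroEquiv k).symm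
  | n + 1 =>
    haveI := instFintype k n
    Fintype.ofEquiv _ (succEquiv k n).symm

theorem sum_zero (f : Vtx k 0 → ℕ) : ∑ t, f t = f root := by
  rw [← (zeroEquiv k).symm.sum_comp]
  simp [zeroEquiv]

theorem sum_succ (f : Vtx k (n + 1) → ℕ) :
    ∑ t, f t = f root + ∑ i, ∑ t, f (child i t) := by
  rw [← (succEquiv k n).symm.sum_comp, Fintype.sum_option, Fintype.sum_prod_type]
  rfl

/-- The distance of a vertex from the root. -/
def level : {n : ℕ} → Vtx k n → ℕ
  | _, root => 0
  | _, child _ t => t.level + 1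

theorem level_eq_zero {t : Vtx k n} : t.level = 0 ↔ t = root := by
  cases t <;> simp [level]

/-- Adjacency in the model tree. -/
def Adj : {n : ℕ} → Vtx k n → Vtx k n → Prop
  | _, root, root => False
  | _, root, child _ t => t = root
  | _, child _ s, root => s = root
  | _, child i s, child j t => i = j ∧ Adj s t

theorem Adj.symm {s t : Vtx k n} (h : Adj s t) : Adj t s := by
  induction s with
  | root => cases t <;> simp_all [Adj]
  | child i s ih =>
    cases t with
    | root => simpa [Adj] using h
    | child j t => exact ⟨h.1.symm, ih h.2⟩

theorem not_adj_self (t : Vtx k n) : ¬ Adj t t := by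
  induction t with
  | root => simp [Adj]
  | child i s ih => simpa [Adj] using ih

end Vtx

open Vtx

/-- The model of the perfect `k`-ary tree of depth `n`. -/
def kary (k n : ℕ) : SimpleGraph (Vtx k n) where
  Adj := Vtx.Adj
  symm := ⟨fun _ _ h => h.symm⟩
  loopless := ⟨not_adj_self⟩

/-- The automorphism of the tree of depth `n + 1` that permutes the subtrees below the root by `σ`
and acts on the `i`-th of them by `ψ i`. -/
def glue {k n : ℕ} (σ : Equiv.Perm (Fin k)) (ψ : Fin k → (kary k n ≃g kary k n))
    (hψ : ∀ i, ψ i root = root) : kary k (n + 1) ≃g kary k (n + 1) where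
  toFun
    | root => root
    | child i t => child (σ i) (ψ i t)
  invFun
    | root => root
    | child i t => child (σ.symm i) ((ψ (σ.symm i)).symm t)
  left_inv := by rintro (_ | _) <;> simp
  right_inv := by rintro (_ | _) <;> simp
  map_rel_iff' := by
    have h0 : ∀ i t, ψ i t = root ↔ t = root := fun i t => by
      rw [← (ψ i).injective.eq_iff (a := t), hψ]
    have h1 : ∀ i s t, Vtx.Adj (ψ i s) (ψ i t) ↔ Vtx.Adj s t := fun i s t =>
      (ψ i).map_rel_iff
    rintro (_ | ⟨i, s⟩) (_ | ⟨j, t⟩)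
    · exact Iff.rfl
    · exact h0 j t
    · exact h0 i s
    · change σ i = σ j ∧ Vtx.Adj _ _ ↔ i = j ∧ Vtx.Adj _ _
      rw [σ.injective.eq_iff]
      refine and_congr_right ?_
      rintro rfl
      exact h1 i s t

variable {α : Type*} {k n : ℕ}

/-- The isomorphism type of a coloured perfect tree of depth `n` in which the coloured subtrees
below any one vertex are pairwise non-isomorphic: the colour of the root together with the set of
the types of the subtrees below it. -/
def Shape (α : Type*) : ℕ → Type _
  | 0 => α
  | n + 1 => α × Finset (Shape α n)

open scoped Classical in
/-- The shape of a colouring of the model tree.  It determines the colouring up to isomorphism if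
the colouring is `Rigid`. -/
noncomputable def shape : {n : ℕ} → (Vtx k n → α) → Shape α n
  | 0, c => c root
  | _ + 1, c => (c root, univ.image fun i => shape fun t => c (child i t))

/-- A colouring of the model tree is rigid if, at every vertex, the coloured subtrees below it have
distinct shapes. -/
def Rigid : {n : ℕ} → (Vtx k n → α) → Prop
  | 0, _ => True
  | _ + 1, c => (∀ i, Rigid fun t => c (child i t)) ∧
      Function.Injective fun i => shape fun t => c (child i t)

open scoped Classical in
/-- The number of vertices whose colour is not `w` in a tree of a given shape. -/
noncomputable def cost (w : α) : {n : ℕ} → Shape α n → ℕ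
  | 0, a => if (show α from a) = w then 0 else 1
  | _ + 1, s => (if s.1 = w then 0 else 1) + ∑ x ∈ s.2, cost w x

/-- The shapes of rigid colourings of the perfect `k`-ary tree of depth `n`. -/
def shapes (α : Type*) [Fintype α] (k : ℕ) : (n : ℕ) → Finset (Shape α n)
  | 0 => (univ : Finset α)
  | n + 1 => (univ : Finset α) ×ˢ powersetCard k (shapes α k n)

theorem mem_shapes_succ [Fintype α] {s : Shape α (n + 1)} :
    s ∈ shapes α k (n + 1) ↔ s.2 ⊆ shapes α k n ∧ #s.2 = k := by
  refine (mem_product (p := s)).trans ?_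
  rw [mem_powersetCard]
  exact and_iff_right (mem_univ _)

theorem cost_zero (w : α) (a : α) [Decidable (a = w)] :
    cost w (n := 0) a = if a = w then 0 else 1 := by
  simp only [cost]
  congr

theorem cost_succ (w : α) (a : α) (X : Finset (Shape α n)) [Decidable (a = w)] :
    cost w (n := n + 1) (a, X) = (if a = w then 0 else 1) + ∑ x ∈ X, cost w x := by
  simp only [cost]
  congr

theorem cost_zero_eq_zero_iff {w a : α} : cost w (n := 0) a = 0 ↔ a = w := by
  classical
  refine (Eq.congr_left (cost_zero w a)).trans ?_
  split_ifs with h <;> simp [h]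

theorem cost_one [DecidableEq α] (w a : α) (X : Finset α) :
    cost w (n := 1) (a, X) = (if a = w then 0 else 1) + #(X.erase w) := by
  refine (cost_succ (n := 0) w a X).trans ?_
  congr 1
  rw [← filter_ne', card_filter]
  refine sum_congr rfl fun (x : α) _ => ?_
  rw [ite_not]
  exact cost_zero w x

theorem Rigid.shape_mem [Fintype α] : ∀ {n : ℕ} {c : Vtx k n → α}, Rigid c →
    shape c ∈ shapes α k n
  | 0, c, _ => mem_univ (α := α) _
  | n + 1, c, h => by
    classical
    rw [mem_shapes_succ]
    refine ⟨?_, ?_⟩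
    · simp only [shape, image_subset_iff]
      exact fun i _ => (h.1 i).shape_mem
    · simp only [shape]
      rw [card_image_of_injective _ h.2, card_fin]

open scoped Classical in
theorem Rigid.cost_shape (w : α) : ∀ {n : ℕ} {c : Vtx k n → α}, Rigid c →
    cost w (shape c) = ∑ t, if c t = w then 0 else 1
  | 0, c, _ => by rw [sum_zero]; rfl
  | n + 1, c, h => by
    rw [sum_succ]
    simp only [shape, cost]
    rw [sum_image fun i _ j _ hij => h.2 hij]
    congr 1
    exact sum_congr rfl fun i _ => (h.1 i).cost_shape w

/-- Every element of `shapes` is realised by a rigid colouring. -/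
theorem exists_rigid_of_mem_shapes [Fintype α] : ∀ {n : ℕ} {s : Shape α n}, s ∈ shapes α k n →
    ∃ c : Vtx k n → α, Rigid c ∧ shape c = s
  | 0, s, _ => ⟨fun _ => s, trivial, rfl⟩
  | n + 1, s, h => by
    classical
    rw [mem_shapes_succ] at h
    let e : Fin k ≃ s.2 := (Fintype.equivFinOfCardEq (by simpa using h.2)).symm
    choose c hc hs using fun i => exists_rigid_of_mem_shapes (h.1 (e i).2)
    refine ⟨fun | root => s.1 | child i t => c i t, ⟨hc, ?_⟩, ?_⟩
    · intro i j hij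
      simp only [hs] at hij
      exact e.injective (Subtype.ext hij)
    · simp only [shape, hs]
      refine Prod.ext rfl ?_
      ext x
      simp only [mem_image, mem_univ, true_and]
      constructor
      · rintro ⟨i, rfl⟩; exact (e i).2
      · intro hx; exact ⟨e.symm ⟨x, hx⟩, by simp⟩

/-- Rigid colourings of the same shape are isomorphic. -/
theorem Rigid.exists_iso : ∀ {n : ℕ} {c c' : Vtx k n → α}, Rigid c → Rigid c' →
    shape c = shape c' → ∃ ψ : kary k n ≃g kary k n, ψ root = root ∧ ∀ t, c' (ψ t) = c t
  | 0, c, c', _, _, hs => ⟨RelIso.refl _, rfl, by rintro (_ | _); exact hs.symm⟩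
  | n + 1, c, c', h, h', hs => by
    classical
    have hroot : c root = c' root := congrArg Prod.fst hs
    have himg := congrArg Prod.snd hs
    simp only [shape] at himg
    have hex : ∀ i, ∃ j, shape (fun t => c' (child j t)) = shape fun t => c (child i t) := by
      intro i
      have : shape (fun t => c (child i t)) ∈
          univ.image fun i => shape fun t => c (child i t) := mem_image_of_mem _ (mem_univ i)
      rw [himg] at this
      simpa using this
    choose σ hσ using hex
    have hinj : Function.Injective σ := by
      intro i j hij
      apply h.2
      change shape _ = shape _
      rw [← hσ i, ← hσ j, hij]
    choose ψ hψ hc using fun i => (h.1 i).exists_iso (h'.1 (σ i)) (hσ i).symm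
    refine ⟨glue (Equiv.ofBijective σ (Finite.injective_iff_bijective.1 hinj)) ψ hψ, rfl, ?_⟩
    rintro (_ | ⟨i, t⟩)
    · exact hroot.symm
    · exact hc i t

/-- A colouring that is not rigid is preserved by a nontrivial automorphism: two isomorphic
coloured subtrees below the same vertex can be swapped. -/
theorem exists_iso_of_not_rigid : ∀ {n : ℕ} {c : Vtx k n → α}, ¬ Rigid c →
    ∃ ψ : kary k n ≃g kary k n, ψ root = root ∧ (∀ t, c (ψ t) = c t) ∧ ∃ t, ψ t ≠ t
  | 0, c, h => (h trivial).elim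
  | n + 1, c, h => by
    classical
    by_cases hr : ∀ i, Rigid fun t => c (child i t)
    · have hinj : ¬ Function.Injective fun i => shape fun t => c (child i t) :=
        fun hi => h ⟨hr, hi⟩
      simp only [Function.Injective, not_forall] at hinj
      obtain ⟨i, j, hs, hij⟩ := hinj
      have hsw : ∀ l, shape (fun t => c (child l t)) =
          shape fun t => c (child (Equiv.swap i j l) t) := by
        intro l
        rcases eq_or_ne l i with rfl | hi
        · rw [Equiv.swap_apply_left]; exact hs
        rcases eq_or_ne l j with rfl | hj
        · rw [Equiv.swap_apply_right]; exact hs.symm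
        · rw [Equiv.swap_apply_of_ne_of_ne hi hj]
      choose ψ hψ hc using fun l => (hr l).exists_iso (hr (Equiv.swap i j l)) (hsw l)
      refine ⟨glue (Equiv.swap i j) ψ hψ, rfl, ?_, child i root, ?_⟩
      · rintro (_ | ⟨l, t⟩)
        · rfl
        · exact hc l t
      · change child (Equiv.swap i j i) _ ≠ _
        rw [Equiv.swap_apply_left]
        intro he
        injection he with _ h1
        exact hij h1.symm
    · push Not at hr
      obtain ⟨i, hi⟩ := hr
      obtain ⟨ψ, hψ, hc, t, ht⟩ := exists_iso_of_not_rigid hi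
      refine ⟨glue (Equiv.refl _) (fun l => if l = i then ψ else RelIso.refl _) ?_, rfl, ?_,
        child i t, ?_⟩
      · intro l
        by_cases hl : l = i <;> simp [hl, hψ]
      · rintro (_ | ⟨l, s⟩)
        · rfl
        · by_cases hl : l = i
          · subst hl
            simpa [glue] using hc s
          · simp [glue, hl]
      · simpa [glue] using ht

end PaintCost

/-! ### Perfect trees and the model -/

namespace PaintCost

open Finset

open Vtx

variable {V : Type*} {k N : ℕ}

/-- A description of `G` as a perfect `k`-ary tree of depth `N` with root `r`, in which `child v i`
is the `i`-th child of `v`.  At a vertex of depth `N` the value of `child` is meaningless. -/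
structure IsRooting (G : SimpleGraph V) (k N : ℕ) (r : V) (child : V → Fin k → V) : Prop where
  dist_le : ∀ v, G.dist r v ≤ N
  eq_root : ∀ v, G.dist r v = 0 → v = r
  adj_child : ∀ v i, G.dist r v < N → G.Adj v (child v i)
  dist_child : ∀ v i, G.dist r v < N → G.dist r (child v i) = G.dist r v + 1
  child_inj : ∀ v, G.dist r v < N → Function.Injective (child v)
  exists_child : ∀ v w, G.Adj v w → G.dist r w = G.dist r v + 1 → ∃ i, child v i = w
  exists_parent : ∀ v, G.dist r v ≠ 0 → ∃ u i, G.dist r u + 1 = G.dist r v ∧ child u i = v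
  parent_unique : ∀ u u' v, G.Adj u v → G.Adj u' v → G.dist r v = G.dist r u + 1 →
    G.dist r v = G.dist r u' + 1 → u = u'
  dist_adj : ∀ u v, G.Adj u v → G.dist r u = G.dist r v + 1 ∨ G.dist r v = G.dist r u + 1
  dist_map : ∀ (φ : G ≃g G) (v : V), G.dist r (φ v) = G.dist r v

/-- A shortest path from the root is continued in only one way towards the root: the neighbour of
`v` that is closer to the root is unique. -/
theorem parent_unique_of_isTree {G : SimpleGraph V} (hT : G.IsTree) (r : V) {u u' v : V}
    (hu : G.Adj u v) (hu' : G.Adj u' v) (h : G.dist r v = G.dist r u + 1)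
    (h' : G.dist r v = G.dist r u' + 1) : u = u' := by
  obtain ⟨p, hp⟩ := hT.connected.exists_walk_length_eq_dist r u
  obtain ⟨q, hq⟩ := hT.connected.exists_walk_length_eq_dist r u'
  have hp' : (p.concat hu).IsPath := SimpleGraph.Walk.isPath_of_length_eq_dist _ (by simp [hp, h])
  have hq' : (q.concat hu').IsPath := SimpleGraph.Walk.isPath_of_length_eq_dist _ (by simp [hq, h'])
  have := (hT.existsUnique_path r v).unique hp' hq'
  simpa using congrArg SimpleGraph.Walk.penultimate this

theorem exists_parent_of_connected {G : SimpleGraph V} (hG : G.Connected) (r : V) {v : V}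
    (h : G.dist r v ≠ 0) : ∃ u, G.Adj u v ∧ G.dist r u < G.dist r v := by
  obtain ⟨p, hp⟩ := hG.exists_walk_length_eq_dist r v
  have hn : ¬ p.Nil := by
    intro hn
    rw [← SimpleGraph.Walk.length_eq_zero_iff] at hn
    omega
  refine ⟨p.penultimate, p.adj_penultimate hn, ?_⟩
  have := SimpleGraph.dist_le p.dropLast
  have h2 : p.dropLast.length = p.length - 1 := by simp
  omega

/-- Automorphisms fixing the root preserve the distance from it. -/
theorem dist_apply_iso {G : SimpleGraph V} (hc : G.Connected) {r : V} (φ : G ≃g G) (h : φ r = r)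
    (v : V) : G.dist r (φ v) = G.dist r v := by
  have key : ∀ ψ : G ≃g G, ψ r = r → ∀ v, G.dist r (ψ v) ≤ G.dist r v := by
    intro ψ h v
    obtain ⟨p, hp⟩ := hc.exists_walk_length_eq_dist r v
    have := SimpleGraph.dist_le (p.map ψ.toHom)
    rw [SimpleGraph.Walk.length_map, hp] at this
    simpa [h] using this
  refine le_antisymm (key φ h v) ?_
  have := key φ.symm (φ.symm_apply_eq.2 h.symm) (φ v)
  rwa [RelIso.symm_apply_apply] at this

/-- Away from the leaves every vertex has exactly `k` neighbours farther from the root. A vertex at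
maximal distance from the root is a leaf, so no vertex is farther than the leaves are, and the
internal vertices are precisely those at distance less than `n`. -/
theorem IsPerfectKaryTree.exists_isRooting [Fintype V] {G : SimpleGraph V} [DecidableRel G.Adj]
    {n : ℕ} (hk : 2 ≤ k) (hG : IsPerfectKaryTree G k n) :
    ∃ r child, IsRooting G k n r child := by
  classical
  obtain ⟨hT, -, r, hr, hleaf, hint⟩ := hG
  have hc := hT.connected
  have hd : ∀ u v, G.Adj u v → G.dist r u = G.dist r v + 1 ∨ G.dist r v = G.dist r u + 1 :=
    fun u v h => hT.dist_eq_dist_add_one_of_adj r h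
  have hzero : ∀ v, G.dist r v = 0 → v = r := fun v h => (hc.dist_eq_zero_iff.1 h).symm
  let C : V → Finset V := fun v => {w ∈ G.neighborFinset v | G.dist r w = G.dist r v + 1}
  have hC : ∀ v w, w ∈ C v ↔ G.Adj v w ∧ G.dist r w = G.dist r v + 1 := by simp [C]
  have hCcard : ∀ v, G.degree v ≠ 1 → #(C v) = k := by
    intro v hv
    by_cases hvr : v = r
    · subst hvr
      rw [← hr, ← G.card_neighborFinset_eq_degree]
      congr 1
      apply filter_true_of_mem
      intro w hw
      rw [SimpleGraph.mem_neighborFinset] at hw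
      have := hd _ _ hw
      simp only [SimpleGraph.dist_self] at this ⊢
      omega
    · have h0 : G.dist r v ≠ 0 := fun h => hvr (hzero v h)
      obtain ⟨u, hu, hlt⟩ := exists_parent_of_connected hc r h0
      have huv : G.dist r v = G.dist r u + 1 := by have := hd _ _ hu; omega
      have : G.neighborFinset v = insert u (C v) := by
        ext w
        rw [SimpleGraph.mem_neighborFinset, mem_insert, hC]
        constructor
        · intro hw
          rcases hd _ _ hw with h | h
          · exact Or.inl (parent_unique_of_isTree hT r hw.symm hu h huv)
          · exact Or.inr ⟨hw, h⟩
        · rintro (rfl | h)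
          · exact hu.symm
          · exact h.1
      have hcard := congrArg card this
      rw [G.card_neighborFinset_eq_degree, hint v hvr hv, card_insert_of_notMem] at hcard
      · omega
      · rw [hC]; omega
  have hle : ∀ v, G.dist r v ≤ n := by
    have : Nonempty V := ⟨r⟩
    obtain ⟨m, hm⟩ := Finite.exists_max fun v => G.dist r v
    have hmleaf : G.degree m = 1 := by
      by_contra h
      have h1 := hCcard m h
      obtain ⟨w, hw⟩ : (C m).Nonempty := card_pos.1 (by omega)
      have h2 := ((hC _ _).1 hw).2
      have h3 := hm w
      omega
    intro v
    rw [← hleaf m hmleaf]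
    exact hm v
  have hnl : ∀ v, G.dist r v < n → #(C v) = k := fun v hv =>
    hCcard v fun h => by have := hleaf v h; omega
  let child : V → Fin k → V := fun v =>
    if h : #(C v) = k then fun i => ((C v).equivFinOfCardEq h).symm i else fun _ => v
  have hchild : ∀ v i, #(C v) = k → child v i ∈ C v := by
    intro v i h
    simp only [child, h, dite_true]
    exact Subtype.prop _
  have hex : ∀ v w, G.Adj v w → G.dist r w = G.dist r v + 1 → ∃ i, child v i = w := by
    intro v w hw h
    have h1 : #(C v) = k := hnl v (by have := hle w; omega)
    refine ⟨(C v).equivFinOfCardEq h1 ⟨w, (hC _ _).2 ⟨hw, h⟩⟩, ?_⟩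
    simp [child, h1]
  refine ⟨r, child, hle, hzero, ?_, ?_, ?_, hex, ?_, ?_, hd, ?_⟩
  · exact fun v i h => ((hC _ _).1 (hchild v i (hnl v h))).1
  · exact fun v i h => ((hC _ _).1 (hchild v i (hnl v h))).2
  · intro v h i j hij
    simp only [child, hnl v h, dite_true] at hij
    exact ((C v).equivFinOfCardEq (hnl v h)).symm.injective (Subtype.ext hij)
  · intro v h
    obtain ⟨u, hu, hlt⟩ := exists_parent_of_connected hc r h
    have huv : G.dist r v = G.dist r u + 1 := by have := hd _ _ hu; omega
    obtain ⟨i, hi⟩ := hex u v hu huv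
    exact ⟨u, i, huv.symm, hi⟩
  · exact fun u u' v h1 h2 h3 h4 => parent_unique_of_isTree hT r h1 h2 h3 h4
  · -- The root is the only vertex of degree `k`.
    refine fun φ => dist_apply_iso hc φ ?_
    by_contra h
    have h1 : G.degree (φ r) = k := by rw [φ.degree_eq, hr]
    have := hint _ h (by omega)
    omega

namespace IsRooting

variable {G : SimpleGraph V} {r : V} {child : V → Fin k → V}

/-- The copy, inside the tree with children `child`, of the model tree rooted at `v`. -/
def emb (child : V → Fin k → V) : {n : ℕ} → V → Vtx k n → V
  | _, v, root => v
  | _, v, .child i t => emb child (child v i) t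

theorem emb_root {n : ℕ} (v : V) : emb child v (root : Vtx k n) = v := by
  simp only [emb]

theorem emb_child {n : ℕ} (v : V) (i : Fin k) (t : Vtx k n) :
    emb child v (.child i t) = emb child (child v i) t := by
  simp only [emb]

variable (h : IsRooting G k N r child)
include h

theorem dist_emb {n : ℕ} {v : V} (hv : G.dist r v + n = N) (t : Vtx k n) :
    G.dist r (emb child v t) = G.dist r v + t.level := by
  induction t generalizing v with
  | root => rw [emb_root]; rfl
  | child i t ih =>
    have h1 := h.dist_child v i (by omega)
    rw [emb_child, ih (by omega), level]
    omega

theorem eq_of_child_eq {v w : V} {i j : Fin k} (hv : G.dist r v < N) (hvw : G.dist r v = G.dist r w)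
    (hij : child v i = child w j) : v = w := by
  have h1 := h.dist_child v i hv
  have h2 := h.adj_child w j (by omega)
  rw [← hij] at h2
  exact h.parent_unique _ _ _ (h.adj_child v i hv) h2 h1 (by omega)

/-- Subtrees rooted at different vertices of the same level are disjoint. -/
theorem eq_of_emb_eq {n : ℕ} {v w : V} (hv : G.dist r v + n = N) (hvw : G.dist r v = G.dist r w)
    {s t : Vtx k n} (hst : emb child v s = emb child w t) : v = w := by
  induction s generalizing v w with
  | root =>
    have h1 := h.dist_emb (hvw ▸ hv) t
    rw [← hst, emb_root] at h1
    obtain rfl := level_eq_zero.1 (by omega : t.level = 0)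
    simpa only [emb_root] using hst
  | child i s ih =>
    have h1 := h.dist_emb hv (.child i s)
    have h2 := h.dist_emb (hvw ▸ hv) t
    have h3 := h.dist_child v i (by omega)
    cases t with
    | root => rw [hst, h2] at h1; simp only [level] at h1; omega
    | child j t =>
      have h4 := h.dist_child w j (by omega)
      rw [emb_child, emb_child] at hst
      exact h.eq_of_child_eq (by omega) hvw (ih (by omega) (by omega) hst)

theorem emb_injective {n : ℕ} {v : V} (hv : G.dist r v + n = N) :
    Function.Injective (emb child v : Vtx k n → V) := by
  intro s t hst
  induction s generalizing v with
  | root =>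
    have h1 := h.dist_emb hv t
    rw [← hst, emb_root] at h1
    exact (level_eq_zero.1 (by omega : t.level = 0)).symm
  | child i s ih =>
    have h1 := h.dist_emb hv (.child i s)
    have h2 := h.dist_emb hv t
    have h3 := h.dist_child v i (by omega)
    cases t with
    | root => rw [hst, h2] at h1; simp only [level] at h1; omega
    | child j t =>
      have h4 := h.dist_child v j (by omega)
      rw [emb_child, emb_child] at hst
      obtain rfl := h.child_inj v (by omega) (h.eq_of_emb_eq (by omega) (by omega) hst)
      rw [ih (by omega) hst]

theorem exists_emb_eq_child {n : ℕ} {v : V} (hv : G.dist r v + n = N) (t : Vtx k n)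
    (ht : G.dist r (emb child v t) < N) (i : Fin k) :
    ∃ s : Vtx k n, emb child v s = child (emb child v t) i := by
  induction t generalizing v with
  | @root n =>
    rw [emb_root] at ht ⊢
    obtain _ | n := n
    · omega
    · exact ⟨.child i root, by rw [emb_child, emb_root]⟩
  | child j t ih =>
    have h1 := h.dist_child v j (by omega)
    rw [emb_child] at ht ⊢
    obtain ⟨s, hs⟩ := ih (by omega) ht
    exact ⟨.child j s, by rw [emb_child, hs]⟩

theorem emb_surjective : Function.Surjective (emb child r : Vtx k N → V) := by
  intro w
  induction hm : G.dist r w generalizing w with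
  | zero => exact ⟨root, by rw [emb_root, h.eq_root w hm]⟩
  | succ m ih =>
    obtain ⟨u, i, hu, rfl⟩ := h.exists_parent w (by omega)
    obtain ⟨t, rfl⟩ := ih u (by omega)
    have := h.dist_le (child (emb child r t) i)
    exact h.exists_emb_eq_child (by simp) t (by omega) i

/-- There are no edges between subtrees rooted at different vertices of the same level. -/
theorem eq_of_adj_emb {n : ℕ} {v w : V} (hv : G.dist r v + n = N) (hvw : G.dist r v = G.dist r w)
    {s t : Vtx k n} (hst : G.Adj (emb child v s) (emb child w t)) : v = w := by
  have hd := h.dist_adj _ _ hst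
  rw [h.dist_emb hv, h.dist_emb (hvw ▸ hv)] at hd
  induction s generalizing v w with
  | root =>
    obtain _ | ⟨i, t⟩ := t
    · simp only [level] at hd; omega
    · simp only [level] at hd
      obtain rfl := level_eq_zero.1 (by omega : t.level = 0)
      rw [emb_root, emb_child, emb_root] at hst
      have h1 := h.dist_child w i (by omega)
      exact h.parent_unique _ _ _ hst (h.adj_child w i (by omega)) (by omega) h1
  | child i s ih =>
    have h1 := h.dist_child v i (by omega)
    obtain _ | ⟨j, t⟩ := t
    · simp only [level] at hd
      obtain rfl := level_eq_zero.1 (by omega : s.level = 0)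
      rw [emb_root, emb_child, emb_root] at hst
      exact h.parent_unique _ _ _ (h.adj_child v i (by omega)) hst.symm h1 (by omega)
    · have h2 := h.dist_child w j (by omega)
      rw [emb_child, emb_child] at hst
      simp only [level] at hd
      exact h.eq_of_child_eq (by omega) hvw (ih (by omega) (by omega) hst (by omega))

theorem adj_emb_iff {n : ℕ} {v : V} (hv : G.dist r v + n = N) (s t : Vtx k n) :
    G.Adj (emb child v s) (emb child v t) ↔ Vtx.Adj s t := by
  have hroot : ∀ {n : ℕ} {v : V}, G.dist r v + (n + 1) = N → ∀ i (t : Vtx k n),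
      G.Adj v (emb child (child v i) t) ↔ t = root := by
    intro n v hv i t
    have h1 := h.dist_child v i (by omega)
    constructor
    · intro ha
      have hd := h.dist_adj _ _ ha
      rw [h.dist_emb (by omega)] at hd
      exact level_eq_zero.1 (by omega)
    · rintro rfl
      rw [emb_root]
      exact h.adj_child v i (by omega)
  induction s generalizing v with
  | root =>
    cases t with
    | root => simp [Vtx.Adj]
    | child j t => rw [emb_root, emb_child, hroot hv, Vtx.Adj]
  | child i s ih =>
    have h1 := h.dist_child v i (by omega)
    cases t with
    | root => rw [emb_root, emb_child, G.adj_comm, hroot hv, Vtx.Adj]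
    | child j t =>
      have h2 := h.dist_child v j (by omega)
      rw [emb_child, emb_child, Vtx.Adj]
      constructor
      · intro ha
        obtain rfl := h.child_inj v (by omega) (h.eq_of_adj_emb (by omega) (by omega) ha)
        exact ⟨rfl, (ih (by omega) t).1 ha⟩
      · rintro ⟨rfl, ha⟩
        exact (ih (by omega) t).2 ha

/-- A perfect `k`-ary tree of depth `N` is isomorphic to the model. -/
noncomputable def iso : kary k N ≃g G where
  toEquiv := Equiv.ofBijective (emb child r) ⟨h.emb_injective (by simp), h.emb_surjective⟩
  map_rel_iff' := h.adj_emb_iff (by simp) _ _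

theorem iso_apply (t : Vtx k N) : h.iso t = emb child r t := rfl

theorem map_child (φ : G ≃g G) {v : V} (hv : G.dist r v < N) (i : Fin k) :
    ∃ j, φ (child v i) = child (φ v) j := by
  have h1 := h.dist_child v i hv
  obtain ⟨j, hj⟩ := h.exists_child (φ v) (φ (child v i)) (φ.map_rel_iff.2 (h.adj_child v i hv))
    (by rw [h.dist_map, h.dist_map, h1])
  exact ⟨j, hj.symm⟩

variable {α : Type*}

/-- A colour-preserving automorphism maps a subtree to a subtree of the same shape. -/
theorem shape_map (c : V → α) (φ : G ≃g G) (hφ : ∀ v, c (φ v) = c v) {n : ℕ} {v : V}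
    (hv : G.dist r v + n = N) :
    (shape fun t : Vtx k n => c (emb child (φ v) t)) = shape fun t : Vtx k n => c (emb child v t) := by
  classical
  -- A single inclusion between the sets of subtrees suffices, applied to `φ` and to its inverse.
  induction n generalizing v φ with
  | zero => simp only [shape, emb_root, hφ]; rfl
  | succ n ih =>
    simp only [shape, emb_root, emb_child, hφ]
    refine Prod.ext rfl ?_
    have key : ∀ (ψ : G ≃g G), (∀ v, c (ψ v) = c v) → ∀ u, G.dist r u + (n + 1) = N →
        (univ.image fun i => shape fun t : Vtx k n => c (emb child (child u i) t)) ⊆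
        univ.image fun i => shape fun t : Vtx k n => c (emb child (child (ψ u) i) t) := by
      intro ψ hψ u hu x hx
      simp only [mem_image, mem_univ, true_and] at hx ⊢
      obtain ⟨i, rfl⟩ := hx
      obtain ⟨j, hj⟩ := h.map_child ψ (v := u) (by omega) i
      refine ⟨j, ?_⟩
      rw [← hj]
      have := h.dist_child u i (by omega)
      exact ih ψ hψ (by omega)
    refine Subset.antisymm ?_ (key φ hφ v hv)
    have := key φ.symm (fun v => by rw [← hφ, RelIso.apply_symm_apply]) (φ v)
      (by rw [h.dist_map]; exact hv)
    simpa only [RelIso.symm_apply_apply] using this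

theorem map_emb_of_rigid (c : V → α) (φ : G ≃g G) (hφ : ∀ v, c (φ v) = c v) {n : ℕ} {v : V}
    (hv : G.dist r v + n = N) (hc : Rigid fun t : Vtx k n => c (emb child v t)) (hfix : φ v = v)
    (t : Vtx k n) : φ (emb child v t) = emb child v t := by
  induction t generalizing v with
  | root => rw [emb_root, hfix]
  | @child n i t ih =>
    rw [emb_child]
    have h1 := h.dist_child v i (by omega)
    obtain ⟨j, hj⟩ := h.map_child φ (v := v) (by omega) i
    rw [hfix] at hj
    have h2 := h.shape_map c φ hφ (v := child v i) (n := n) (by omega)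
    rw [hj] at h2
    have hji := hc.2 (a₁ := j) (a₂ := i) (by simpa only [emb_child] using h2)
    rw [hji] at hj
    refine ih (by omega) ?_ hj
    simpa only [emb_child] using hc.1 i

/-- Distinguishing colourings are exactly the rigid ones. -/
theorem isDistinguishing_iff (c : V → α) :
    IsDistinguishing G c ↔ Rigid fun t : Vtx k N => c (emb child r t) := by
  constructor
  · intro hc
    by_contra hn
    obtain ⟨ψ, -, hψ, t, ht⟩ := exists_iso_of_not_rigid hn
    have h1 := hc ((h.iso.symm.trans ψ).trans h.iso) (by
      intro v
      have := hψ (h.iso.symm v)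
      rw [← h.iso_apply, ← h.iso_apply, RelIso.apply_symm_apply] at this
      simpa using this)
    have h2 := congrArg (fun φ : G ≃g G => φ (h.iso t)) h1
    simp at h2
    exact ht h2
  · intro hc φ hφ
    ext v
    obtain ⟨t, rfl⟩ := h.emb_surjective v
    have hr : φ r = r := h.eq_root _ (by rw [h.dist_map]; simp)
    exact h.map_emb_of_rigid c φ hφ (by simp) hc hr t

open scoped Classical in
/-- Distinguishing colourings with a given number of vertices not coloured `w` correspond to
shapes of a given cost. -/
theorem exists_isDistinguishing_iff [Fintype V] [Fintype α] (w : α) (m : ℕ) :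
    (∃ c : V → α, IsDistinguishing G c ∧ #{v | c v ≠ w} = m) ↔
      ∃ s ∈ shapes α k N, cost w s = m := by
  have hcard : ∀ c : V → α, #{v | c v ≠ w} =
      ∑ t : Vtx k N, if c (emb child r t) = w then 0 else 1 := by
    intro c
    rw [card_filter, ← h.iso.toEquiv.sum_comp]
    refine sum_congr rfl fun t _ => ?_
    change (if c (emb child r t) ≠ w then 1 else 0) = _
    rw [ite_not]
  constructor
  · rintro ⟨c, hc, rfl⟩
    rw [h.isDistinguishing_iff] at hc
    exact ⟨_, hc.shape_mem, by rw [hc.cost_shape, hcard]⟩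
  · rintro ⟨s, hs, rfl⟩
    obtain ⟨c, hc, rfl⟩ := exists_rigid_of_mem_shapes hs
    have h1 : (fun t : Vtx k N => c (h.iso.symm (emb child r t))) = c := by
      funext t
      rw [← h.iso_apply, RelIso.symm_apply_apply]
    refine ⟨fun v => c (h.iso.symm v), ?_, ?_⟩
    · rw [h.isDistinguishing_iff, h1]; exact hc
    · rw [hcard, hc.cost_shape]
      exact sum_congr rfl fun t _ => by rw [congrFun h1 t]

end IsRooting

end PaintCost

/-! ### Counting shapes -/

namespace PaintCost

open Finset

theorem self_le_choose {N j : ℕ} (hj : 1 ≤ j) (hN : j < N) : N ≤ N.choose j := by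
  induction N generalizing j with
  | zero => omega
  | succ N ih =>
    obtain ⟨i, rfl⟩ := Nat.exists_eq_add_of_le' hj
    rw [Nat.choose_succ_succ']
    have h1 : 1 ≤ N.choose i := Nat.choose_pos (by omega)
    rcases (by omega : i + 1 = N ∨ i + 1 < N) with h | h
    · have : N.choose i = N := by subst h; simp
      have h2 : 1 ≤ N.choose (i + 1) := Nat.choose_pos (by omega)
      omega
    · have := ih (j := i + 1) (by omega) h
      omega

/-- If `f` is at least `m` on `X` and attains `m` at most once, all its other values on `X` are at
least `m + 1`. -/
theorem card_mul_add_le_sum {ι : Type*} {X : Finset ι} {f : ι → ℕ} {m : ℕ} (hm : ∀ x ∈ X, m ≤ f x)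
    (hu : ∀ x ∈ X, ∀ y ∈ X, f x = m → f y = m → x = y) : #X * m + (#X - 1) ≤ ∑ x ∈ X, f x := by
  classical
  by_cases hex : ∃ x ∈ X, f x = m
  · obtain ⟨x, hx, hfx⟩ := hex
    rw [← add_sum_erase X f hx]
    have h1 : #(X.erase x) • (m + 1) ≤ ∑ y ∈ X.erase x, f y := by
      refine card_nsmul_le_sum _ _ _ fun y hy => ?_
      have h2 := hm y (mem_of_mem_erase hy)
      have h3 : f y ≠ m := fun h => ne_of_mem_erase hy (hu y (mem_of_mem_erase hy) x hx h hfx)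
      omega
    have hpos : 0 < #X := card_pos.2 ⟨x, hx⟩
    obtain ⟨l, hl⟩ := Nat.exists_eq_add_of_le' hpos
    rw [card_erase_of_mem hx, hl, smul_eq_mul] at h1
    rw [hl]
    simp only [Nat.add_sub_cancel] at h1 ⊢
    nlinarith
  · have h1 : #X • (m + 1) ≤ ∑ y ∈ X, f y := by
      refine card_nsmul_le_sum _ _ _ fun y hy => ?_
      have h2 := hm y hy
      have h3 : f y ≠ m := fun h => hex ⟨y, hy, h⟩
      omega
    rw [smul_eq_mul, mul_add] at h1
    omega

variable {α : Type*} [Fintype α] {k n : ℕ}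

theorem card_shapes_zero : #(shapes α k 0) = Fintype.card α := rfl

theorem card_shapes_succ :
    #(shapes α k (n + 1)) = Fintype.card α * (#(shapes α k n)).choose k := by
  change #((univ : Finset α) ×ˢ powersetCard k (shapes α k n)) = _
  rw [card_product, card_powersetCard, card_univ]

theorem shapes_eq_empty (h : Fintype.card α < k) : shapes α k (n + 1) = ∅ := by
  rw [← card_eq_zero]
  induction n with
  | zero => rw [card_shapes_succ, card_shapes_zero, Nat.choose_eq_zero_of_lt h, mul_zero]
  | succ n ih => rw [card_shapes_succ, ih, Nat.choose_eq_zero_of_lt (by omega), mul_zero]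

theorem card_shapes_of_card_eq (h : Fintype.card α = k) : #(shapes α k n) = k := by
  induction n with
  | zero => exact h
  | succ n ih => rw [card_shapes_succ, ih, h, Nat.choose_self, mul_one]

theorem sum_ite_eq_zero_one [DecidableEq α] (w : α) :
    ∑ a : α, (if a = w then 0 else 1) = Fintype.card α - 1 := by
  rw [← card_univ, ← card_erase_of_mem (mem_univ w), card_eq_sum_ones, ← filter_ne', sum_filter]
  exact sum_congr rfl fun a _ => by simp

/-! ### Exactly `k` colours -/

theorem snd_eq_of_card_eq (h : Fintype.card α = k) {s : Shape α (n + 1)}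
    (hs : s ∈ shapes α k (n + 1)) : s.2 = shapes α k n := by
  rw [mem_shapes_succ] at hs
  exact eq_of_subset_of_card_le hs.1 (by rw [hs.2, card_shapes_of_card_eq h])

/-- With `k` colours, the shapes of depth `n` are the `k` choices of a root colour over one and the
same set of subtrees. -/
theorem sum_cost_of_card_eq (h : Fintype.card α = k) (hk : 1 ≤ k) (w : α) :
    ∑ s ∈ shapes α k n, cost w s = k ^ (n + 1) - 1 := by
  classical
  induction n with
  | zero =>
    change ∑ a : α, cost w (n := 0) a = _
    simp only [cost_zero]
    rw [sum_ite_eq_zero_one, h, zero_add, pow_one]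
  | succ n ih =>
    have h1 : powersetCard k (shapes α k n) = {shapes α k n} := by
      have := powersetCard_self (shapes α k n)
      rwa [card_shapes_of_card_eq h] at this
    change ∑ s ∈ (univ : Finset α) ×ˢ powersetCard k (shapes α k n), cost w (n := n + 1) s = _
    rw [h1]
    refine (sum_product univ {shapes α k n} fun s => cost w (n := n + 1) s).trans ?_
    simp only [sum_singleton, cost_succ]
    rw [sum_add_distrib, sum_ite_eq_zero_one, sum_const, card_univ, ih, h, smul_eq_mul,
      Nat.mul_sub, pow_succ' k (n + 1)]
    have := Nat.mul_le_mul_left k (Nat.one_le_pow (n + 1) k hk)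
    omega

/-- With `k` colours, the set of shapes below the root is forced. -/
theorem cost_of_card_eq (h : Fintype.card α = k) (hk : 1 ≤ k) (w : α) {s : Shape α (n + 1)}
    (hs : s ∈ shapes α k (n + 1)) [Decidable (s.1 = w)] :
    cost w s = (if s.1 = w then 0 else 1) + (k ^ (n + 1) - 1) := by
  rw [← sum_cost_of_card_eq h hk w, ← snd_eq_of_card_eq h hs]
  exact cost_succ w s.1 s.2

/-! ### Lower bounds -/

theorem mul_le_cost_succ (w : α) {m : ℕ} (h : ∀ s ∈ shapes α k n, m ≤ cost w s)
    {s : Shape α (n + 1)} (hs : s ∈ shapes α k (n + 1)) : k * m ≤ cost w s := by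
  classical
  rw [mem_shapes_succ] at hs
  have h1 : #s.2 • m ≤ ∑ x ∈ s.2, cost w x := card_nsmul_le_sum s.2 (cost w) m fun x hx => h x (hs.1 hx)
  rw [hs.2, smul_eq_mul] at h1
  have h2 := cost_succ w s.1 s.2
  change cost w s = _ at h2
  omega

/-- A shape of the least conceivable cost has a root coloured `w`, and all the shapes below it have
the least possible cost. -/
theorem of_cost_eq_mul (w : α) {m : ℕ} (h : ∀ s ∈ shapes α k n, m ≤ cost w s)
    {s : Shape α (n + 1)} (hs : s ∈ shapes α k (n + 1)) (hc : cost w s = k * m) :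
    s.1 = w ∧ ∀ x ∈ s.2, cost w x = m := by
  classical
  rw [mem_shapes_succ] at hs
  have h1 : #s.2 • m ≤ ∑ x ∈ s.2, cost w x := card_nsmul_le_sum s.2 (cost w) m fun x hx => h x (hs.1 hx)
  rw [hs.2, smul_eq_mul] at h1
  have h2 := cost_succ w s.1 s.2
  change cost w s = _ at h2
  have h3 : s.1 = w := by
    by_contra h3
    rw [if_neg h3] at h2
    omega
  refine ⟨h3, ?_⟩
  have h4 : ∑ _x ∈ s.2, m = ∑ x ∈ s.2, cost w x := by
    rw [sum_const, hs.2, smul_eq_mul]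
    rw [if_pos h3] at h2
    omega
  intro x hx
  exact ((sum_eq_sum_iff_of_le fun x hx => h x (hs.1 hx)).1 h4 x hx).symm

theorem mul_add_le_cost_succ (w : α) {m : ℕ} (h : ∀ s ∈ shapes α k n, m ≤ cost w s)
    (hu : ∀ s ∈ shapes α k n, ∀ t ∈ shapes α k n, cost w s = m → cost w t = m → s = t)
    {s : Shape α (n + 1)} (hs : s ∈ shapes α k (n + 1)) : k * m + (k - 1) ≤ cost w s := by
  classical
  rw [mem_shapes_succ] at hs
  have h1 := card_mul_add_le_sum (X := s.2) (f := cost w) (m := m) (fun x hx => h x (hs.1 hx))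
    fun x hx y hy => hu x (hs.1 hx) y (hs.1 hy)
  rw [hs.2] at h1
  have h2 := cost_succ w s.1 s.2
  change cost w s = _ at h2
  omega

/-- In every group of `k` sibling leaves at most one is coloured `w`. -/
theorem le_cost (w : α) {s : Shape α (n + 1)} (hs : s ∈ shapes α k (n + 1)) :
    k ^ n * (k - 1) ≤ cost w s := by
  classical
  induction n with
  | zero =>
    have := mul_add_le_cost_succ w (m := 0) (fun _ _ => Nat.zero_le _) ?_ hs
    · simpa using this
    · intro a _ b _ ha hb
      exact (cost_zero_eq_zero_iff.1 ha).trans (cost_zero_eq_zero_iff.1 hb).symm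
  | succ n ih =>
    rw [pow_succ', mul_assoc]
    exact mul_le_cost_succ w (fun s hs => ih hs) hs

theorem mem_shapes_one {a : α} {X : Finset α} :
    ((a, X) : Shape α 1) ∈ shapes α k 1 ↔ #X = k :=
  mem_shapes_succ.trans (and_iff_right (subset_univ (α := α) X))

/-- With `k + 1` colours, a shape of depth `1` and of least cost is determined by the one colour
other than `w` that it misses. -/
theorem card_filter_cost_one_le (hk : 2 ≤ k) (h : Fintype.card α = k + 1) (w : α) :
    #{s ∈ shapes α k 1 | cost w s = k - 1} ≤ k := by
  classical
  have hcard : #(powersetCard (k - 1) ((univ : Finset α).erase w)) = k := by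
    rw [card_powersetCard, card_erase_of_mem (mem_univ w), card_univ, h, Nat.add_sub_cancel]
    rw [← Nat.choose_symm (by omega), Nat.sub_sub_self (by omega), Nat.choose_one_right]
  have key : ∀ s : α × Finset α, (s : Shape α 1) ∈ shapes α k 1 →
      cost w (n := 1) s = k - 1 → s.1 = w ∧ w ∈ s.2 := by
    rintro ⟨a, X⟩ hs hc
    have hs := mem_shapes_one.1 hs
    have hc := (cost_one w a X).symm.trans hc
    by_cases hw : w ∈ X
    · rw [card_erase_of_mem hw, hs] at hc
      refine ⟨?_, hw⟩
      by_contra ha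
      rw [if_neg ha] at hc
      omega
    · rw [erase_eq_of_notMem hw] at hc
      omega
  refine (card_le_card_of_injOn (fun s : Shape α 1 => Finset.erase (α := α) s.2 w) ?_ ?_).trans hcard.le
  · intro s hs
    rw [mem_coe, mem_filter] at hs
    have h1 := key s hs.1 hs.2
    refine mem_coe.2 (mem_powersetCard.2 ⟨erase_subset_erase _ (subset_univ (α := α) _), ?_⟩)
    rw [card_erase_of_mem h1.2, mem_shapes_one.1 hs.1]
  · intro s hs t ht hst
    rw [mem_coe, mem_filter] at hs
    rw [mem_coe, mem_filter] at ht
    have h1 := key s hs.1 hs.2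
    have h2 := key t ht.1 ht.2
    refine Prod.ext (h1.1.trans h2.1.symm) ?_
    rw [← insert_erase h1.2, ← insert_erase h2.2]
    exact congrArg (insert w) hst

/-- With `k + 1` colours there is only one shape of depth `2` and of least cost. -/
theorem eq_of_cost_two_eq (hk : 2 ≤ k) (h : Fintype.card α = k + 1) (w : α) {s t : Shape α 2}
    (hs : s ∈ shapes α k 2) (ht : t ∈ shapes α k 2) (hsc : cost w s = k * (k - 1))
    (htc : cost w t = k * (k - 1)) : s = t := by
  have key : ∀ s ∈ shapes α k 2, cost w s = k * (k - 1) →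
      s = (w, {s ∈ shapes α k 1 | cost w s = k - 1}) := by
    intro s hs hc
    have h1 := of_cost_eq_mul w (m := k - 1) (fun s hs => by simpa using le_cost w hs) hs hc
    rw [mem_shapes_succ] at hs
    refine Prod.ext h1.1 (eq_of_subset_of_card_le ?_ ?_)
    · exact fun x hx => mem_filter.2 ⟨hs.1 hx, h1.2 x hx⟩
    · rw [hs.2]
      exact card_filter_cost_one_le hk h w
  rw [key s hs hsc, key t ht htc]

/-- Among `k` sibling subtrees of depth `2` at most one has the least cost `k * (k - 1)`. -/
theorem le_cost_of_card_eq_succ (hk : 2 ≤ k) (h : Fintype.card α = k + 1) (w : α)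
    {s : Shape α (n + 3)} (hs : s ∈ shapes α k (n + 3)) :
    (k - 1) * (k ^ 2 + 1) * k ^ n ≤ cost w s := by
  induction n with
  | zero =>
    have := mul_add_le_cost_succ (n := 2) w (m := k * (k - 1))
      (fun s hs => by simpa using le_cost w hs)
      (fun s hs t ht => eq_of_cost_two_eq hk h w hs ht) hs
    refine le_trans (le_of_eq ?_) this
    ring
  | succ n ih =>
    refine le_trans (le_of_eq ?_) (mul_le_cost_succ w (fun s hs => ih hs) hs)
    ring

/-! ### Constructions -/

/-- Enough shapes of the same cost remain available when passing to the next depth. -/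
theorem exists_subset_shapes_mul (hk : 1 ≤ k) (w : α) {m : ℕ} {B : Finset (Shape α n)}
    (hB : B ⊆ shapes α k n) (hm : ∀ s ∈ B, cost w s = m) (hcard : k + 1 ≤ #B) :
    ∃ B' ⊆ shapes α k (n + 1), (∀ s ∈ B', cost w s = k * m) ∧ k + 1 ≤ #B' := by
  classical
  refine ⟨(({w} : Finset α) ×ˢ powersetCard k B : Finset (α × Finset (Shape α n))), ?_, ?_, ?_⟩
  · intro s hs
    have hs := mem_product.1 hs
    have h2 := mem_powersetCard.1 hs.2
    exact mem_shapes_succ.2 ⟨h2.1.trans hB, h2.2⟩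
  · intro s hs
    have hs := mem_product.1 hs
    have h2 := mem_powersetCard.1 hs.2
    refine (cost_succ w s.1 s.2).trans ?_
    rw [if_pos (mem_singleton.1 hs.1), sum_congr rfl fun x hx => hm x (h2.1 hx), sum_const, h2.2,
      smul_eq_mul, zero_add]
  · refine hcard.trans ?_
    change _ ≤ #(({w} : Finset α) ×ˢ powersetCard k B)
    rw [card_product, card_singleton, one_mul, card_powersetCard]
    exact self_le_choose hk hcard

/-- More than `k` shapes of depth `n` and cost `m` propagate to depth `n + j`. The depth is passed as
`p` so that it can be written in either order. -/
theorem exists_mem_shapes_mul_pow (hk : 1 ≤ k) (w : α) {m : ℕ} {B : Finset (Shape α n)}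
    (hB : B ⊆ shapes α k n) (hm : ∀ s ∈ B, cost w s = m) (hcard : k + 1 ≤ #B) (j : ℕ)
    {p : ℕ} (hp : n + j = p) : ∃ s ∈ shapes α k p, cost w s = k ^ j * m := by
  subst hp
  have : ∃ B' ⊆ shapes α k (n + j), (∀ s ∈ B', cost w s = k ^ j * m) ∧ k + 1 ≤ #B' := by
    induction j with
    | zero => exact ⟨B, hB, by simpa using hm, hcard⟩
    | succ j ih =>
      obtain ⟨B', h1, h2, h3⟩ := ih
      obtain ⟨B'', h1, h2, h3⟩ := exists_subset_shapes_mul hk w h1 h2 h3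
      exact ⟨B'', h1, fun s hs => by rw [h2 s hs, pow_succ', mul_assoc], h3⟩
  obtain ⟨B', h1, h2, h3⟩ := this
  obtain ⟨s, hs⟩ : B'.Nonempty := card_pos.1 (by omega)
  exact ⟨s, h1 hs, h2 s hs⟩

/-- Shapes with a root coloured `w` and, below it, a given shape `s₀` and `k - 1` shapes from a
given set. -/
theorem exists_subset_shapes_insert (hk : 1 ≤ k) (w : α) {m₀ m : ℕ} {s₀ : Shape α n}
    {B : Finset (Shape α n)} (hs₀ : s₀ ∈ shapes α k n) (hm₀ : cost w s₀ = m₀)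
    (hB : B ⊆ shapes α k n) (hm : ∀ s ∈ B, cost w s = m) (hs₀B : s₀ ∉ B) :
    ∃ B' ⊆ shapes α k (n + 1), (∀ s ∈ B', cost w s = m₀ + (k - 1) * m) ∧
      #B' = (#B).choose (k - 1) := by
  classical
  refine ⟨(({w} : Finset α) ×ˢ (powersetCard (k - 1) B).image (insert s₀) :
    Finset (α × Finset (Shape α n))), ?_, ?_, ?_⟩
  · intro s hs
    obtain ⟨X, hX, hs2⟩ := mem_image.1 (mem_product.1 hs).2
    rw [mem_powersetCard] at hX
    rw [mem_shapes_succ, ← hs2, card_insert_of_notMem fun h => hs₀B (hX.1 h)]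
    exact ⟨insert_subset hs₀ (hX.1.trans hB), by omega⟩
  · intro s hs
    obtain ⟨X, hX, hs2⟩ := mem_image.1 (mem_product.1 hs).2
    rw [mem_powersetCard] at hX
    refine (cost_succ w s.1 s.2).trans ?_
    rw [if_pos (mem_singleton.1 (mem_product.1 hs).1), ← hs2,
      sum_insert fun h => hs₀B (hX.1 h), hm₀, sum_congr rfl fun x hx => hm x (hX.1 hx), sum_const,
      hX.2, smul_eq_mul, zero_add]
  · change #(({w} : Finset α) ×ˢ (powersetCard (k - 1) B).image (insert s₀)) = _
    rw [card_product, card_singleton, one_mul, card_image_of_injOn, card_powersetCard]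
    intro X hX Y hY hXY
    rw [mem_coe, mem_powersetCard] at hX hY
    rw [← erase_insert fun h => hs₀B (hX.1 h), ← erase_insert fun h => hs₀B (hY.1 h)]
    exact congrArg (fun Z => Z.erase s₀) hXY

/-- Shapes of depth `1` and of least cost: one leaf is coloured `w`, and the `k - 1` others receive
different colours. -/
theorem exists_subset_shapes_one (hk : 1 ≤ k) (w : α) :
    ∃ B ⊆ shapes α k 1, (∀ s ∈ B, cost w s = k - 1) ∧
      #B = (Fintype.card α - 1).choose (k - 1) := by
  classical
  obtain ⟨B, h1, h2, h3⟩ := exists_subset_shapes_insert (n := 0) (m₀ := 0) (m := 1) hk w (s₀ := w)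
    (B := (univ : Finset α).erase w) (mem_univ (α := α) w) ((cost_zero w w).trans (if_pos rfl))
    (subset_univ (α := α) _)
    (fun a ha => (cost_zero w a).trans (if_neg (ne_of_mem_erase ha)))
    (notMem_erase (α := α) w _)
  refine ⟨B, h1, fun s hs => by simpa using h2 s hs, h3.trans ?_⟩
  change (#((univ : Finset α).erase w)).choose (k - 1) = _
  rw [card_erase_of_mem (mem_univ _), card_univ]

/-- With at least `k + 2` colours the least conceivable cost is attained. -/
theorem exists_cost_eq_of_lt_card (hk : 2 ≤ k) (h : k + 1 < Fintype.card α) (w : α) :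
    ∃ s ∈ shapes α k (n + 1), cost w s = k ^ n * (k - 1) := by
  obtain ⟨B, h1, h2, h3⟩ := exists_subset_shapes_one (k := k) (by omega) w
  have := self_le_choose (N := Fintype.card α - 1) (j := k - 1) (by omega) (by omega)
  exact exists_mem_shapes_mul_pow (by omega) w h1 h2 (by omega) n (add_comm 1 n)

/-- With `k + 1` colours, all `k` shapes of depth `1` and of least cost are available. -/
theorem exists_subset_shapes_one_of_card_eq_succ (hk : 2 ≤ k) (h : Fintype.card α = k + 1)
    (w : α) : ∃ B ⊆ shapes α k 1, (∀ s ∈ B, cost w s = k - 1) ∧ #B = k := by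
  obtain ⟨B, h1, h2, h3⟩ := exists_subset_shapes_one (k := k) (by omega) w
  refine ⟨B, h1, h2, ?_⟩
  rw [h3, h, Nat.add_sub_cancel, ← Nat.choose_symm (by omega), Nat.sub_sub_self (by omega),
    Nat.choose_one_right]

theorem exists_cost_two_eq (hk : 2 ≤ k) (h : Fintype.card α = k + 1) (w : α) :
    ∃ s ∈ shapes α k 2, cost w s = k * (k - 1) := by
  classical
  obtain ⟨B, h1, h2, h3⟩ := exists_subset_shapes_one_of_card_eq_succ hk h w
  refine ⟨(w, B), mem_shapes_succ.2 ⟨h1, h3⟩, (cost_succ w w B).trans ?_⟩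
  rw [if_pos rfl, sum_congr rfl h2, sum_const, h3, smul_eq_mul, zero_add]

/-- With `k + 1` colours there is a single shape of depth `2` and of least cost, but more than `k`
shapes whose cost is larger by one: recolour the root of the cheapest shape, or replace one of the
shapes of depth `1` in it by the one whose leaves avoid `w`. -/
theorem exists_cost_eq_of_card_eq_succ (hk : 2 ≤ k) (h : Fintype.card α = k + 1) (w : α) :
    ∃ s ∈ shapes α k (n + 3), cost w s = (k - 1) * (k ^ 2 + 1) * k ^ n := by
  classical
  obtain ⟨B, h1, h2, h3⟩ := exists_subset_shapes_one_of_card_eq_succ hk h w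
  have hU : #((univ : Finset α).erase w) = k := by
    rw [card_erase_of_mem (mem_univ w), card_univ, h, Nat.add_sub_cancel]
  obtain ⟨y, hy⟩ : B.Nonempty := card_pos.1 (by omega)
  let x : Shape α 1 := (w, (univ : Finset α).erase w)
  have hx : x ∈ shapes α k 1 := mem_shapes_one.2 hU
  have hxc : cost w x = k := by
    refine (cost_one w w _).trans ?_
    rw [if_pos rfl, erase_idem, hU, zero_add]
  have hxB : x ∉ B.erase y := fun hx => by
    have := h2 x (mem_of_mem_erase hx)
    omega
  let C : Finset (Shape α 1) := insert x (B.erase y)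
  have hC : #C = k := by
    rw [card_insert_of_notMem hxB, card_erase_of_mem hy]
    omega
  obtain ⟨l, rfl⟩ : ∃ l, k = l + 2 := ⟨k - 2, by omega⟩
  -- `D` consists of the shapes `(a, B)` with `a ≠ w` and of the shape `(w, C)`.
  let D : Finset (α × Finset (Shape α 1)) :=
    insert (w, C) (((univ : Finset α).erase w) ×ˢ {B})
  have hD : #D = l + 3 := by
    rw [card_insert_of_notMem (fun hs => ne_of_mem_erase (mem_product.1 hs).1 rfl),
      card_product, hU, card_singleton, mul_one]
  have hmem : ∀ s : α × Finset (Shape α 1), s ∈ D → s = (w, C) ∨ (s.1 ≠ w ∧ s.2 = B) := by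
    intro s hs
    rcases mem_insert.1 hs with hs | hs
    · exact Or.inl hs
    · exact Or.inr ⟨ne_of_mem_erase (mem_product.1 hs).1, mem_singleton.1 (mem_product.1 hs).2⟩
  obtain ⟨B', g1, g2, g3⟩ := exists_subset_shapes_insert (n := 2) (m₀ := (l + 2) * (l + 1))
    (m := (l + 2) * (l + 1) + 1) (k := l + 2) (by omega) w (s₀ := (w, B)) (B := D)
    (mem_shapes_succ.2 ⟨h1, h3⟩)
    (by
      refine (cost_succ w w B).trans ?_
      rw [if_pos rfl, sum_congr rfl h2, sum_const, h3, smul_eq_mul, zero_add]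
      rfl)
    (by
      intro s hs
      rcases hmem s hs with rfl | ⟨-, hs⟩
      · exact mem_shapes_succ.2 ⟨insert_subset hx ((erase_subset _ _).trans h1), hC⟩
      · refine mem_shapes_succ.2 ?_
        rw [hs]
        exact ⟨h1, h3⟩)
    (by
      intro s hs
      rcases hmem s hs with rfl | ⟨hs1, hs2⟩
      · refine (cost_succ w w C).trans ?_
        rw [if_pos rfl, sum_insert hxB, hxc, sum_congr rfl fun z hz => h2 z (mem_of_mem_erase hz),
          sum_const, card_erase_of_mem hy, h3, smul_eq_mul]
        simp only [Nat.add_succ_sub_one]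
        ring
      · refine (cost_succ w s.1 s.2).trans ?_
        rw [if_neg hs1, hs2, sum_congr rfl h2, sum_const, h3, smul_eq_mul]
        simp only [Nat.add_succ_sub_one]
        ring)
    (by
      intro hs
      rcases hmem _ hs with hs | ⟨hs, -⟩
      · have : B = C := congrArg Prod.snd hs
        have hxB' := h2 x (this ▸ mem_insert_self _ _)
        omega
      · exact hs rfl)
  have g4 : #B' = (l + 3).choose (l + 1) := by rw [g3]; congr 1
  have := self_le_choose (N := l + 3) (j := l + 1) (by omega) (by omega)
  obtain ⟨s, hs, hc⟩ := exists_mem_shapes_mul_pow (by omega) w g1 g2 (by omega) n (add_comm 3 n)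
  refine ⟨s, hs, hc.trans ?_⟩
  simp only [Nat.add_succ_sub_one]
  ring

end PaintCost

/-! ### Numerical invariants of perfect trees -/

namespace PaintCost

open Finset

variable {V : Type*} {G : SimpleGraph V} {k n : ℕ}

/-- The complement of a colour class of a distinguishing colouring is a fixing set. -/
theorem isFixingSet_of_isDistinguishing [Fintype V] {α : Type*} {c : V → α} (w : α)
    (hc : IsDistinguishing G c) [DecidablePred fun v => c v ≠ w] :
    IsFixingSet G {v | c v ≠ w} := by
  intro φ hφ
  have h1 : ∀ v, c v ≠ w → φ v = v := fun v hv => hφ v (by simpa using hv)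
  refine hc φ fun v => ?_
  by_cases hv : c v = w
  · by_contra hne
    -- A vertex outside the class of `w` has no preimage but itself.
    have h2 := h1 (φ v) (by rwa [hv] at hne)
    exact hne (congrArg c (φ.injective h2))
  · rw [h1 v hv]

open scoped Classical in
/-- A fixing set becomes the complement of a colour class when its vertices receive distinct
colours. -/
theorem IsFixingSet.isDistinguishing {S : Finset V} (hS : IsFixingSet G S) :
    IsDistinguishing G fun v => if v ∈ S then some v else none := by
  intro φ hφ
  refine hS φ fun v hv => ?_
  have h1 := hφ v
  simp only [if_pos hv] at h1
  split_ifs at h1 with h2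
  exact Option.some_injective _ h1

namespace IsRooting

variable [Fintype V] {r : V} {child : V → Fin k → V} (h : IsRooting G k n r child)
include h

theorem isDistinguishable_iff (hn : 1 ≤ n) (hk : 1 ≤ k) (d : ℕ) : IsDistinguishable G d ↔ k ≤ d := by
  obtain ⟨n, rfl⟩ := Nat.exists_eq_add_of_le' hn
  constructor
  · rintro ⟨c, hc⟩
    by_contra hd
    rw [h.isDistinguishing_iff] at hc
    have := hc.shape_mem
    rw [shapes_eq_empty (by simpa using hd)] at this
    exact notMem_empty _ this
  · intro hd
    have : ∀ m, k ≤ #(shapes (Fin d) k m) := by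
      intro m
      induction m with
      | zero => rw [card_shapes_zero, Fintype.card_fin]; exact hd
      | succ m ih =>
        rw [card_shapes_succ, Fintype.card_fin]
        exact hd.trans (Nat.le_mul_of_pos_right _ (Nat.choose_pos ih))
    obtain ⟨s, hs⟩ : (shapes (Fin d) k (n + 1)).Nonempty := card_pos.1 (hk.trans (this _))
    obtain ⟨c, hc, -⟩ := (h.exists_isDistinguishing_iff (⟨0, by omega⟩ : Fin d) _).2 ⟨s, hs, rfl⟩
    exact ⟨c, hc⟩

theorem distNumber_eq (hn : 1 ≤ n) (hk : 1 ≤ k) : distNumber G = k := by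
  have : {d | IsDistinguishable G d} = Set.Ici k :=
    Set.ext fun d => h.isDistinguishable_iff hn hk d
  rw [distNumber, this, csInf_Ici]

theorem paintCost_eq {d m : ℕ} (hex : ∃ w : Fin d, ∃ s ∈ shapes (Fin d) k n, cost w s = m)
    (hle : ∀ w : Fin d, ∀ s ∈ shapes (Fin d) k n, m ≤ cost w s) : paintCost G d = m := by
  classical
  refine IsLeast.csInf_eq ⟨?_, ?_⟩
  · obtain ⟨w, hw⟩ := hex
    obtain ⟨c, hc, hm⟩ := (h.exists_isDistinguishing_iff w m).2 hw
    exact ⟨c, w, hc, by convert hm⟩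
  · rintro _ ⟨c, w, hc, rfl⟩
    obtain ⟨s, hs, hm⟩ := (h.exists_isDistinguishing_iff w _).1 ⟨c, hc, rfl⟩
    have := hle w s hs
    rw [hm] at this
    exact this.trans_eq (by congr!)

theorem paintCost_self (hn : 1 ≤ n) (hk : 1 ≤ k) : paintCost G k = k ^ n - 1 := by
  classical
  obtain ⟨n, rfl⟩ := Nat.exists_eq_add_of_le' hn
  have hc : Fintype.card (Fin k) = k := Fintype.card_fin k
  refine h.paintCost_eq ⟨⟨0, hk⟩, (⟨0, hk⟩, shapes (Fin k) k n),
    mem_shapes_succ.2 ⟨Subset.rfl, card_shapes_of_card_eq hc⟩, ?_⟩ ?_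
  · refine (cost_succ _ _ _).trans ?_
    rw [if_pos rfl, sum_cost_of_card_eq hc hk, zero_add]
  · intro w s hs
    rw [cost_of_card_eq hc hk w hs]
    omega

theorem paintCost_of_lt (hn : 1 ≤ n) (hk : 2 ≤ k) {d : ℕ} (hd : k + 1 < d) :
    paintCost G d = k ^ (n - 1) * (k - 1) := by
  obtain ⟨n, rfl⟩ := Nat.exists_eq_add_of_le' hn
  exact h.paintCost_eq
    ⟨⟨0, by omega⟩, exists_cost_eq_of_lt_card hk (by simpa using hd) _⟩ fun w s hs => le_cost w hs

theorem le_card_of_isFixingSet (hn : 1 ≤ n) {S : Finset V} (hS : IsFixingSet G S) :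
    k ^ (n - 1) * (k - 1) ≤ #S := by
  classical
  obtain ⟨n, rfl⟩ := Nat.exists_eq_add_of_le' hn
  obtain ⟨s, hs, hm⟩ := (h.exists_isDistinguishing_iff (none : Option V) #S).1
    ⟨_, hS.isDistinguishing, by congr 1; ext v; simp⟩
  rw [← hm]
  exact le_cost _ hs

theorem fixNumber_eq (hn : 1 ≤ n) (hk : 2 ≤ k) : fixNumber G = k ^ (n - 1) * (k - 1) := by
  classical
  refine IsLeast.csInf_eq ⟨?_, ?_⟩
  · obtain ⟨n, rfl⟩ := Nat.exists_eq_add_of_le' hn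
    obtain ⟨c, hc, hm⟩ := (h.exists_isDistinguishing_iff (0 : Fin (k + 2)) _).2
      (exists_cost_eq_of_lt_card hk (by simp) 0)
    exact ⟨_, isFixingSet_of_isDistinguishing 0 hc, by simpa using hm⟩
  · rintro _ ⟨S, hS, rfl⟩
    exact h.le_card_of_isFixingSet hn hS

/-- The frugal distinguishing number, from the values of the paint cost. -/
theorem frugalNumber_eq (hn : 1 ≤ n) (hk : 1 ≤ k) {D : ℕ} (hD : k ≤ D)
    (heq : paintCost G D = fixNumber G)
    (hne : ∀ d, k ≤ d → d < D → paintCost G d ≠ fixNumber G) : frugalNumber G = D := by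
  refine IsLeast.csInf_eq ⟨⟨(h.isDistinguishable_iff hn hk D).2 hD, heq⟩, ?_⟩
  rintro d ⟨hd, hd'⟩
  by_contra hlt
  exact hne d ((h.isDistinguishable_iff hn hk d).1 hd) (not_le.1 hlt) hd'

end IsRooting

theorem map_Ico_eq_replicate {f : ℕ → ℕ} {a b m : ℕ} (hf : ∀ d, a ≤ d → d < b → f d = m) :
    (List.Ico a b).map f = List.replicate (b - a) m := by
  rw [List.eq_replicate_iff]
  refine ⟨by simp, fun x hx => ?_⟩
  obtain ⟨d, hd, rfl⟩ := List.mem_map.1 hx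
  rw [List.Ico.mem] at hd
  exact hf d hd.1 hd.2

section Spectra

variable [Fintype V] [DecidableRel G.Adj]

theorem IsPerfectKaryTree.spectrum_one (hk : 2 ≤ k) (hG : IsPerfectKaryTree G k 1) :
    paintCostSpectrum G = (k, [k - 1]) ∧ paintCostRatio G = 1 := by
  obtain ⟨r, child, h⟩ := hG.exists_isRooting hk
  obtain ⟨l, rfl⟩ : ∃ l, k = l + 2 := ⟨k - 2, by omega⟩
  have hdist := h.distNumber_eq le_rfl (by omega)
  have hfix := h.fixNumber_eq le_rfl hk
  have hself := h.paintCost_self le_rfl (by omega)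
  simp only [Nat.sub_self, pow_zero, one_mul, pow_one, Nat.add_succ_sub_one] at hfix hself
  have hfr := h.frugalNumber_eq le_rfl (by omega) le_rfl (by rw [hself, hfix]) (by omega)
  refine ⟨?_, ?_⟩
  · rw [paintCostSpectrum, hdist, hfix, List.Ico.eq_cons (by omega), List.Ico.eq_nil_of_le le_rfl]
    simp [hself]
  · rw [paintCostRatio, hdist, hfix, hfr]
    push_cast
    exact div_self (by ring_nf; norm_num)

theorem IsPerfectKaryTree.spectrum_two (hk : 2 ≤ k) (hG : IsPerfectKaryTree G k 2) :
    paintCostSpectrum G =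
        (k, (k ^ 2 - 1) :: List.replicate (k ^ 2 - 2 * k + 1) (k * (k - 1))) ∧
      paintCostRatio G = ((k : ℚ) ^ 2 - 2 * k + 1) / ((k : ℚ) ^ 2 - 2 * k + 2) := by
  obtain ⟨r, child, h⟩ := hG.exists_isRooting hk
  obtain ⟨l, rfl⟩ : ∃ l, k = l + 2 := ⟨k - 2, by omega⟩
  have hn : 1 ≤ 2 := by omega
  have hdist := h.distNumber_eq hn (by omega)
  have hfix := h.fixNumber_eq hn hk
  have hself := h.paintCost_self hn (by omega)
  simp only [Nat.add_one_sub_one, pow_one] at hfix hself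
  have hcost : ∀ d, l + 2 < d → paintCost G d = (l + 2) * (l + 1) := by
    intro d hd
    rcases (by omega : d = l + 3 ∨ l + 3 < d) with rfl | hd
    · refine h.paintCost_eq ⟨0, exists_cost_two_eq hk (by simp) _⟩ fun w s hs => ?_
      simpa using le_cost w hs
    · simpa using h.paintCost_of_lt hn hk hd
  have hge : l + 2 ≤ (l + 2) * (l + 1) := Nat.le_mul_of_pos_right _ (by omega)
  have hfr := h.frugalNumber_eq hn (by omega) (D := l + 3) (by omega)
    (by rw [hcost _ (by omega), hfix]) (by
      intro d h1 h2
      obtain rfl : d = l + 2 := by omega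
      rw [hself, hfix]
      have : (l + 2) ^ 2 = (l + 2) * (l + 1) + (l + 2) := by ring
      omega)
  refine ⟨?_, ?_⟩
  · rw [paintCostSpectrum, hdist, hfix, List.Ico.eq_cons (by omega), List.map_cons, hself,
      map_Ico_eq_replicate fun d h1 _ => hcost d h1]
    congr 3
    have h1 : (l + 2) ^ 2 = (l + 2) * (l + 1) + (l + 2) := by ring
    have h2 : (l + 2) * (l + 1) = l * (l + 1) + 2 * (l + 1) := by ring
    omega
  · rw [paintCostRatio, hdist, hfix, hfr]
    push_cast
    congr 1 <;> ring

theorem IsPerfectKaryTree.spectrum_of_three_le (hk : 2 ≤ k) (hn : 3 ≤ n)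
    (hG : IsPerfectKaryTree G k n) :
    paintCostSpectrum G =
        (k, (k ^ n - 1) :: ((k - 1) * (k ^ 2 + 1) * k ^ (n - 3)) ::
          List.replicate (k ^ (n - 1) * (k - 1) - k) (k ^ (n - 1) * (k - 1))) ∧
      paintCostRatio G =
        ((k : ℚ) ^ (n - 1) * ((k : ℚ) - 1) - k) /
          ((k : ℚ) ^ (n - 1) * ((k : ℚ) - 1) - k + 2) := by
  obtain ⟨r, child, h⟩ := hG.exists_isRooting hk
  obtain ⟨l, rfl⟩ : ∃ l, k = l + 2 := ⟨k - 2, by omega⟩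
  obtain ⟨m, rfl⟩ := Nat.exists_eq_add_of_le' hn
  replace hn : 1 ≤ m + 3 := by omega
  have hdist := h.distNumber_eq hn (by omega)
  have hfix := h.fixNumber_eq hn hk
  have hself := h.paintCost_self hn (by omega)
  have hsucc : paintCost G (l + 3) = (l + 1) * ((l + 2) ^ 2 + 1) * (l + 2) ^ m :=
    h.paintCost_eq ⟨0, exists_cost_eq_of_card_eq_succ hk (by simp) _⟩
      fun w s hs => le_cost_of_card_eq_succ hk (by simp) w hs
  have hcost : ∀ d, l + 4 ≤ d → paintCost G d = (l + 2) ^ (m + 2) * (l + 1) :=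
    fun d hd => h.paintCost_of_lt hn hk hd
  simp only [Nat.add_succ_sub_one] at hfix hself
  have hfr := h.frugalNumber_eq hn (by omega) (D := l + 4) (by omega)
    (by rw [hcost _ le_rfl, hfix]) (by
      intro d h1 h2
      rw [hfix]
      rcases (by omega : d = l + 2 ∨ d = l + 3) with rfl | rfl
      · rw [hself]
        have h3 : (l + 2) ^ (m + 3) = (l + 2) ^ (m + 2) * (l + 1) + (l + 2) ^ (m + 2) := by ring
        have h4 : 1 < (l + 2) ^ (m + 2) := Nat.one_lt_pow (by omega) (by omega)
        omega
      · rw [hsucc]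
        have h3 : (l + 1) * ((l + 2) ^ 2 + 1) * (l + 2) ^ m =
          (l + 2) ^ (m + 2) * (l + 1) + (l + 1) * (l + 2) ^ m := by ring
        have h4 : 0 < (l + 1) * (l + 2) ^ m := by positivity
        omega)
  have hge : l + 2 ≤ (l + 2) ^ (m + 2) * (l + 1) := by
    rw [pow_succ', mul_assoc]
    exact Nat.le_mul_of_pos_right _ (by positivity)
  refine ⟨?_, ?_⟩
  · rw [paintCostSpectrum, hdist, hfix, List.Ico.eq_cons (by omega), List.Ico.eq_cons (by omega),
      List.map_cons, List.map_cons, hself, hsucc,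
      map_Ico_eq_replicate fun d h1 _ => hcost d h1]
    simp only [Nat.add_sub_cancel, Nat.add_succ_sub_one]
    congr 4
    omega
  · rw [paintCostRatio, hdist, hfix, hfr]
    push_cast
    congr 1 <;> ring

end Spectra

end PaintCost

theorem theorem6 {V : Type*} [Fintype V] (G : SimpleGraph V) [DecidableRel G.Adj] (k n : ℕ)
    (hk : 2 ≤ k) (hG : PaintCost.IsPerfectKaryTree G k n) :
    (n = 1 →
      PaintCost.paintCostSpectrum G = (k, [k - 1]) ∧
      PaintCost.paintCostRatio G = 1) ∧
    (n = 2 →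
      PaintCost.paintCostSpectrum G =
        (k, (k ^ 2 - 1) :: List.replicate (k ^ 2 - 2 * k + 1) (k * (k - 1))) ∧
      PaintCost.paintCostRatio G = ((k : ℚ) ^ 2 - 2 * k + 1) / ((k : ℚ) ^ 2 - 2 * k + 2)) ∧
    (3 ≤ n →
      PaintCost.paintCostSpectrum G =
        (k, (k ^ n - 1) :: ((k - 1) * (k ^ 2 + 1) * k ^ (n - 3)) ::
          List.replicate (k ^ (n - 1) * (k - 1) - k) (k ^ (n - 1) * (k - 1))) ∧
      PaintCost.paintCostRatio G =
        ((k : ℚ) ^ (n - 1) * ((k : ℚ) - 1) - k) / ((k : ℚ) ^ (n - 1) * ((k : ℚ) - 1) - k + 2)) := by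
  refine ⟨?_, ?_, fun hn => hG.spectrum_of_three_le hk hn⟩
  · rintro rfl
    exact hG.spectrum_one hk
  · rintro rfl
    exact hG.spectrum_two hk
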